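/- Let $\lambda_s>0$, $P_c\in(0,1]$, $R_{th}>0$, $\alpha>2$ and $\gamma>0$. Small cell base stations (SBSs) form a homogeneous Poisson point process $\Phi_s=\{X_n\}_{n\in\mathbb N}$ of intensity $\lambda_s$ in $\mathbb R^2$. Each SBS caches a random subset of a finite content library $\mathcal C$; the caches are independent of each other, and each of them contains a given content $c\in\mathcal C$ with probability $P_c$. The channel gains $h_n$ from the SBSs to the user at the origin are i.i.d. exponential with mean $1$ (Rayleigh fading). The reference link of the user has gain $h_0$, exponential with mean $1$, and length $R$, whose law is that of the distance from the origin to the nearest SBS caching $c$, conditioned on there being such an SBS within distance $R_{th}$. The reference link is not part of $\Phi_s$: the point positions $(X_n)$, the caches, the gains $(h_n)$, $h_0$ and $R$ are mutually independent. All SBSs of $\Phi_s$ interfere, noise is neglected, and $$\mathrm{SIR}=\frac{h_0R^{-\alpha}}{\sum_{n}h_n|X_n|^{-\alpha}} .$$ Then the content outage probability $\mathbb P_{out}(c)=\mathbb P(\mathrm{SIR}<\gamma)$ equals $$\mathbb P_{out}(c)=1-\frac{P_c\left(1-e^{-\lambda_s(P_c+\kappa\gamma^{2/\alpha})\pi R_{th}^2}\right)}{\left(1-e^{-\lambda_sP_c\pi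 R_{th}^2}\right)\left(P_c+\kappa\gamma^{2/\alpha}\right)},\qquad \kappa=\Gamma\!\left(1+\tfrac2\alpha\right)\Gamma\!\left(1-\tfrac2\alpha\right).$$ Moreover, if every SBS caches a uniformly chosen $d$-element subset of $\mathcal C$, then $P_c=d/|\mathcal C|$. -/

import Mathlib

open MeasureTheory ProbabilityTheory
open scoped ENNReal NNReal

noncomputable section

namespace CacheNet

/-- The Euclidean plane; the reference user sits at the origin. -/
abbrev Plane : Type := EuclideanSpace ℝ (Fin 2)

/-- Number of points (counted with multiplicity) of the configuration `(X n ω)ₙ` lying in `B`. -/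
def pointCount {Ω : Type*} (X : ℕ → Ω → Plane) (B : Set Plane) (ω : Ω) : ℕ∞ :=
  {n : ℕ | X n ω ∈ B}.encard

/-- `(X n)ₙ` is a measurable enumeration of a homogeneous Poisson point process of intensity `lam`
in the plane: counts in Borel sets of finite area are Poisson with mean `lam * area`, and counts in
finitely many pairwise disjoint such sets are independent.  (For `lam > 0` such a process has
almost surely infinitely many points, so enumerating it by `ℕ` loses nothing.) -/
structure IsHomogeneousPPP {Ω : Type*} [MeasurableSpace Ω] (P : Measure Ω)
    (X : ℕ → Ω → Plane) (lam : ℝ) : Prop where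
  measurable : ∀ n, Measurable (X n)
  count_law : ∀ B : Set Plane, MeasurableSet B → volume B ≠ ∞ →
    HasLaw (pointCount X B)
      ((poissonMeasure (lam.toNNReal * (volume B).toNNReal)).map (fun k : ℕ => (k : ℕ∞))) P
  count_indep : ∀ (m : ℕ) (B : Fin m → Set Plane), (∀ i, MeasurableSet (B i)) →
    (∀ i, volume (B i) ≠ ∞) → Pairwise (fun i j => Disjoint (B i) (B j)) →
    iIndepFun (fun i => pointCount X (B i)) P

/-- Distance from the origin to the nearest base station that caches content `c`
(`∞` if there is none); `K n ω` is the set of contents cached by station `n`. -/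
def nearestCachingDist {Ω 𝒞 : Type*} (X : ℕ → Ω → Plane) (K : ℕ → Ω → Set 𝒞) (c : 𝒞)
    (ω : Ω) : ℝ≥0∞ :=
  ⨅ n : ℕ, ⨅ _ : c ∈ K n ω, ‖X n ω‖ₑ

/-- Cache hit: some station caching `c` lies within distance `Rth` of the user. -/
def hitEvent {Ω 𝒞 : Type*} (X : ℕ → Ω → Plane) (K : ℕ → Ω → Set 𝒞) (c : 𝒞) (Rth : ℝ) :
    Set Ω :=
  {ω | nearestCachingDist X K c ω < ENNReal.ofReal Rth}

/-- Aggregate interference at the origin from all base stations, with fading gains `h n`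
and path loss exponent `α`. -/
def interference {Ω : Type*} (α : ℝ) (X : ℕ → Ω → Plane) (h : ℕ → Ω → ℝ) (ω : Ω) : ℝ≥0∞ :=
  ∑' n : ℕ, ENNReal.ofReal (h n ω) * ‖X n ω‖ₑ ^ (-α)

/-- Signal-to-interference ratio of a reference link of length `R` and fading gain `h₀`. -/
def sir {Ω : Type*} (α : ℝ) (X : ℕ → Ω → Plane) (h : ℕ → Ω → ℝ) (h₀ R : Ω → ℝ) (ω : Ω) :
    ℝ≥0∞ :=
  ENNReal.ofReal (h₀ ω) * ENNReal.ofReal (R ω) ^ (-α) / interference α X h ω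

/-- Cache-enabled small cell network with a reference link for content `c`: stations `X`, caches
`K`, fading gains `h` of the stations, and length `R` and fading gain `h₀` of the reference link. -/
structure IsCacheNetwork {Ω : Type*} [MeasurableSpace Ω] (P : Measure Ω) {𝒞 : Type*} [Finite 𝒞]
    (c : 𝒞) (lam Pc Rth : ℝ) (X : ℕ → Ω → Plane) (K : ℕ → Ω → Set 𝒞)
    (h : ℕ → Ω → ℝ) (h₀ R : Ω → ℝ) : Prop where
  /-- The base stations form a homogeneous Poisson point process of intensity `lam`. -/
  ppp : IsHomogeneousPPP P X lam
  cache_measurable : ∀ n, Measurable (K n)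
  /-- The stations choose their caches independently of each other. -/
  cache_indep : iIndepFun K P
  /-- Each station stores the content `c` with probability `Pc`. -/
  cache_prob : ∀ n, P.real {ω | c ∈ K n ω} = Pc
  fading_measurable : ∀ n, Measurable (h n)
  /-- Rayleigh fading: the interfering gains are i.i.d. exponential with mean `1`. -/
  fading_indep : iIndepFun h P
  fading_law : ∀ n, HasLaw (h n) (expMeasure 1) P
  ref_fading_measurable : Measurable h₀
  ref_fading_law : HasLaw h₀ (expMeasure 1) P
  ref_dist_measurable : Measurable R
  /-- The reference distance has the law of the distance to the nearest station caching `c`,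
  conditioned on there being one within distance `Rth`. -/
  ref_dist_law : IdentDistrib R (fun ω => (nearestCachingDist X K c ω).toReal)
    P (P[|hitEvent X K c Rth])
  /-- Positions, caches, interfering gains, reference gain and reference distance are mutually
  independent (in particular the reference link is not part of the point process). -/
  indep : iIndep (![
    MeasurableSpace.comap (fun ω n => X n ω) inferInstance,
    MeasurableSpace.comap (fun ω n => K n ω) inferInstance,
    MeasurableSpace.comap (fun ω n => h n ω) inferInstance,
    MeasurableSpace.comap h₀ inferInstance,
    MeasurableSpace.comap R inferInstance] : Fin 5 → MeasurableSpace Ω) P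

/-- Every station stores a uniformly chosen `d`-element subset of the library `𝒞`. -/
def UniformCaching {Ω : Type*} [MeasurableSpace Ω] (P : Measure Ω) {𝒞 : Type*}
    (K : ℕ → Ω → Set 𝒞) (d : ℕ) : Prop :=
  d ≤ Nat.card 𝒞 ∧ ∀ n, ∀ S : Set 𝒞, S.ncard = d →
    P.real {ω | K n ω = S} = ((Nat.card 𝒞).choose d : ℝ)⁻¹

/-- Content outage probability: the probability that the reference link misses the SIR target. -/
def contentOutageProb {Ω : Type*} [MeasurableSpace Ω] (P : Measure Ω) (α γ : ℝ)
    (X : ℕ → Ω → Plane) (h : ℕ → Ω → ℝ) (h₀ R : Ω → ℝ) : ℝ :=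
  P.real {ω | sir α X h h₀ R ω < ENNReal.ofReal γ}

/-- The constant `κ = Γ(1 + 2/α) Γ(1 - 2/α)`. -/
def kappa (α : ℝ) : ℝ := Real.Gamma (1 + 2 / α) * Real.Gamma (1 - 2 / α)

end CacheNet

end

/-!
The proof rests on the Laplace functional of the Poisson process,
`E exp (-∑ f (Xₙ)) = exp (-lam ∫ (1 - e^(-f)))`, here for every measurable `f` with values in
`[0, ∞]` (`IsHomogeneousPPP.lintegral_negExp_tsum`).  For a simple `f` supported on a set of finite
area it is the product of the Laplace transforms of independent Poisson counts, and both sides are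
continuous along increasing sequences.  If the points carry independent marks, averaging over
the marks first replaces `e^(-f)` by its mean `q` (`IsHomogeneousPPP.lintegral_negExp_tsum_marked`).

With the caches as marks, this gives the void probabilities of the caching stations, so that the
squared distance to the nearest one is exponential of rate `a = lam * Pc * π`
(`hasLaw_sq_nearestCachingDist`), and `R ^ 2` is such a variable conditioned to lie below `Rth ^ 2`.

With the gains as marks, it gives the Laplace transform of the interference at `s`, namely
`exp (-lam ∫ (1 - (1 + s ‖x‖^(-α))⁻¹) dx) = exp (-lam π κ s^(2/α))`
(`IsCacheNetwork.lintegral_negExp_interference`).  The area integral needs no polar coordinates: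
for independent standard exponential `E`, `H` the integrand is `P(E < s H ‖x‖^(-α))`, so the
integral is the expected area `π s^(2/α) E[H^(2/α)] E[E^(-2/α)]` of a disc, and the two moments are
the Gamma values in `κ` (`lintegral_one_sub_inv_one_add`).

Since `h₀` is exponential, `P(SIR ≥ γ)` is the expectation of the transform of the interference at
`s = γ R^α`, that is of `e^(-b R²)` with `b = lam π κ γ^(2/α)`
(`IsCacheNetwork.measure_le_sir`).  The law of `R²` then gives
`a / (a + b) * (1 - e^(-(a + b) Rth²)) / (1 - e^(-a Rth²))`.
-/

/-! ### The exponential of minus an extended nonnegative real -/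

namespace CacheNet

open Filter Topology

/-- `e⁻ˣ` for `x ∈ [0, ∞]`, with `e^(-∞) = 0`. -/
noncomputable def negExp (x : ℝ≥0∞) : ℝ≥0∞ := EReal.exp (-(x : EReal))

/-- `-log y`, the inverse of `negExp` on `[0, 1]`. -/
noncomputable def negLog (y : ℝ≥0∞) : ℝ≥0∞ := (-(ENNReal.log y)).toENNReal

@[simp] lemma negExp_zero : negExp 0 = 1 := by simp [negExp]

@[simp] lemma negExp_top : negExp ∞ = 0 := by simp [negExp]

lemma negExp_antitone : Antitone negExp := fun x y h => by
  simp only [negExp, EReal.exp_le_exp_iff, EReal.neg_le_neg_iff]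
  exact_mod_cast h

lemma negExp_le_one (x : ℝ≥0∞) : negExp x ≤ 1 := by
  simpa using negExp_antitone (zero_le : 0 ≤ x)

lemma negExp_ne_top (x : ℝ≥0∞) : negExp x ≠ ∞ :=
  ((negExp_le_one x).trans_lt ENNReal.one_lt_top).ne

@[fun_prop]
lemma continuous_negExp : Continuous negExp :=
  ENNReal.continuous_exp.comp (continuous_neg.comp continuous_coe_ennreal_ereal)

@[fun_prop]
lemma measurable_negExp : Measurable negExp := continuous_negExp.measurable

lemma negExp_add (x y : ℝ≥0∞) : negExp (x + y) = negExp x * negExp y := by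
  rw [negExp, EReal.coe_ennreal_add, EReal.neg_add (by simp) (by simp), sub_eq_add_neg,
    EReal.exp_add]
  rfl

lemma negExp_sum {ι : Type*} (s : Finset ι) (f : ι → ℝ≥0∞) :
    negExp (∑ i ∈ s, f i) = ∏ i ∈ s, negExp (f i) := by
  classical
  induction s using Finset.induction_on with
  | empty => simp
  | insert a s ha ih => rw [Finset.sum_insert ha, Finset.prod_insert ha, negExp_add, ih]

lemma negExp_ofReal {x : ℝ} (hx : 0 ≤ x) :
    negExp (ENNReal.ofReal x) = ENNReal.ofReal (Real.exp (-x)) := by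
  rw [negExp, EReal.coe_ennreal_ofReal, max_eq_left hx, ← EReal.coe_neg, EReal.exp_coe]

lemma negExp_mul_natCast (a : ℝ≥0∞) (k : ℕ) : negExp (a * k) = negExp a ^ k := by
  have := negExp_sum (Finset.range k) (fun _ => a)
  simpa [mul_comm] using this

lemma negExp_negLog {y : ℝ≥0∞} (hy : y ≤ 1) : negExp (negLog y) = y := by
  have h : 0 ≤ -(ENNReal.log y) := by
    rw [EReal.le_neg]; simpa using hy
  rw [negExp, negLog, EReal.coe_toENNReal h, neg_neg, ENNReal.exp_log]

@[fun_prop]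
lemma measurable_negLog : Measurable negLog := by
  unfold negLog
  exact (measurable_neg.comp ENNReal.measurable_log).ereal_toENNReal

/-- Dominated convergence for `negExp`, which is bounded by `1`. -/
lemma tendsto_lintegral_negExp {Ω : Type*} [MeasurableSpace Ω] {P : Measure Ω}
    [IsFiniteMeasure P] {f : ℕ → Ω → ℝ≥0∞} {g : Ω → ℝ≥0∞} (hf : ∀ k, Measurable (f k))
    (hfg : ∀ ω, Tendsto (fun k => f k ω) atTop (𝓝 (g ω))) :
    Tendsto (fun k => ∫⁻ ω, negExp (f k ω) ∂P) atTop (𝓝 (∫⁻ ω, negExp (g ω) ∂P)) := by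
  refine tendsto_lintegral_of_dominated_convergence (fun _ => 1)
    (fun k => measurable_negExp.comp (hf k)) (fun k => ae_of_all _ fun ω => negExp_le_one _)
    (by simp) (ae_of_all _ fun ω => ?_)
  exact (continuous_negExp.tendsto _).comp (hfg ω)

end CacheNet

/-! ### The Laplace functional of a Poisson process -/

namespace CacheNet

open Filter Topology

/-- The Laplace transform of a Poisson variable. -/
lemma lintegral_negExp_poissonMeasure (r : ℝ≥0) (a : ℝ≥0∞) :
    ∫⁻ k : ℕ, negExp (a * k) ∂(poissonMeasure r) = negExp (r * (1 - negExp a)) := by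
  obtain ⟨q, hq⟩ : ∃ q : ℝ≥0, (q : ℝ≥0∞) = negExp a :=
    ⟨_, ENNReal.coe_toNNReal (negExp_ne_top a)⟩
  have hq1 : (q : ℝ) ≤ 1 := by
    have := negExp_le_one a
    rw [← hq] at this
    exact_mod_cast this
  have hsum : HasSum (fun k : ℕ => Real.exp (-r) * r ^ k / (k.factorial : ℝ) * (q : ℝ) ^ k)
      (Real.exp (-(r * (1 - q)))) := by
    convert! (NormedSpace.expSeries_div_hasSum_exp ((r : ℝ) * q)).mul_left (Real.exp (-r)) using 1
    · ext k; rw [mul_pow]; ring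
    · rw [← Real.exp_eq_exp_ℝ, ← Real.exp_add]; congr 1; ring
  rw [poissonMeasure, lintegral_sum_measure]
  have h1 : (r : ℝ≥0∞) * (1 - negExp a) = ENNReal.ofReal (r * (1 - q)) := by
    rw [ENNReal.ofReal_mul r.coe_nonneg, ENNReal.ofReal_sub _ q.coe_nonneg, ← hq]; simp
  rw [h1, negExp_ofReal (mul_nonneg r.coe_nonneg (by linarith)), ← hsum.tsum_eq,
    ENNReal.ofReal_tsum_of_nonneg (fun k => by positivity) hsum.summable]
  refine tsum_congr fun k => ?_
  rw [lintegral_smul_measure, lintegral_dirac, negExp_mul_natCast, ← hq,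
    ENNReal.ofReal_mul (by positivity), ENNReal.ofReal_pow q.coe_nonneg]
  simp

lemma tsum_indicator_const_eq_mul_pointCount {Ω : Type*} (X : ℕ → Ω → Plane) (B : Set Plane)
    (a : ℝ≥0∞) (ω : Ω) :
    ∑' n, B.indicator (fun _ => a) (X n ω) = a * (pointCount X B ω : ℝ≥0∞) := by
  rw [pointCount, mul_comm, ← ENNReal.tsum_set_const, tsum_subtype {n | X n ω ∈ B} (fun _ => a)]
  rfl

variable {Ω : Type*} [MeasurableSpace Ω] {P : Measure Ω}
  {X : ℕ → Ω → Plane} {lam : ℝ}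

lemma IsHomogeneousPPP.measurable_pointCount (hX : IsHomogeneousPPP P X lam) {B : Set Plane}
    (hB : MeasurableSet B) : Measurable (fun ω => (pointCount X B ω : ℝ≥0∞)) := by
  have : (fun ω => (pointCount X B ω : ℝ≥0∞))
      = fun ω => ∑' n, B.indicator (fun _ => (1 : ℝ≥0∞)) (X n ω) := by
    ext ω; rw [tsum_indicator_const_eq_mul_pointCount, one_mul]
  rw [this]
  exact Measurable.tsum fun n => (measurable_const.indicator hB).comp (hX.measurable n)

lemma IsHomogeneousPPP.lintegral_negExp_pointCount (hX : IsHomogeneousPPP P X lam)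
    {B : Set Plane} (hB : MeasurableSet B) (hB' : volume B ≠ ∞) (a : ℝ≥0∞) :
    ∫⁻ ω, negExp (a * (pointCount X B ω : ℝ≥0∞)) ∂P
      = negExp (ENNReal.ofReal lam * volume B * (1 - negExp a)) := by
  rw [(hX.count_law B hB hB').lintegral_comp (f := fun k : ℕ∞ => negExp (a * (k : ℝ≥0∞)))
    .of_discrete, lintegral_map .of_discrete .of_discrete]
  simp only [ENat.toENNReal_coe]
  rw [lintegral_negExp_poissonMeasure, ENNReal.coe_mul, ENNReal.coe_toNNReal hB']
  rfl

/-- For a simple function supported on a set of finite area the sum over the points is a linear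
combination of independent Poisson counts. -/
lemma IsHomogeneousPPP.lintegral_negExp_tsum_simpleFunc [IsProbabilityMeasure P]
    (hX : IsHomogeneousPPP P X lam)
    (g : SimpleFunc Plane ℝ≥0∞) (hg : ∀ y ≠ 0, volume (g ⁻¹' {y}) ≠ ∞) :
    ∫⁻ ω, negExp (∑' n, g (X n ω)) ∂P
      = negExp (ENNReal.ofReal lam * ∫⁻ x, (1 - negExp (g x))) := by
  classical
  set s : Finset ℝ≥0∞ := g.range.erase 0
  have hs0 : ∀ y ∈ s, y ≠ 0 := fun y hy => Finset.ne_of_mem_erase hy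
  have hsum : ∀ ω, ∑' n, g (X n ω) = ∑ y ∈ s, y * (pointCount X (g ⁻¹' {y}) ω : ℝ≥0∞) := by
    intro ω
    simp_rw [← tsum_indicator_const_eq_mul_pointCount]
    rw [← Summable.tsum_finsetSum fun _ _ => ENNReal.summable]
    refine tsum_congr fun n => ?_
    simp only [Set.indicator_apply, Set.mem_preimage, Set.mem_singleton_iff]
    rw [Finset.sum_ite_eq]
    by_cases h : g (X n ω) = 0
    · simp [h]
    · rw [if_pos]
      exact Finset.mem_erase.2 ⟨h, g.mem_range_self _⟩
  -- The value `0` is left out of `s` since its fiber may have infinite area.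
  have hindep :
      iIndepFun (fun y : s => fun ω => y.1 * (pointCount X (g ⁻¹' {y.1}) ω : ℝ≥0∞)) P := by
    have h := hX.count_indep s.card (fun i => g ⁻¹' {(s.equivFin.symm i).1})
      (fun i => g.measurableSet_fiber _) (fun i => hg _ (hs0 _ (s.equivFin.symm i).2))
      (fun i j hij => by
        refine Disjoint.preimage _ (Set.disjoint_singleton.2 fun h => hij ?_)
        exact s.equivFin.symm.injective (Subtype.ext h))
    have h2 := h.precomp s.equivFin.injective
    have h3 := h2.comp (fun (y : s) (k : ℕ∞) => y.1 * (k : ℝ≥0∞)) (fun _ => .of_discrete)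
    simpa [Function.comp_def] using h3
  have hm : ∀ y : s, Measurable fun ω => y.1 * (pointCount X (g ⁻¹' {y.1}) ω : ℝ≥0∞) := fun y =>
    (hX.measurable_pointCount (g.measurableSet_fiber _)).const_mul _
  simp_rw [hsum, negExp_sum, ← Finset.prod_coe_sort s]
  have hprod := lintegral_prod_eq_prod_lintegral_of_indepFun Finset.univ _
    (hindep.comp (fun _ => negExp) fun _ => measurable_negExp)
    fun y => measurable_negExp.comp (hm y)
  simp only [Function.comp_apply] at hprod
  rw [hprod, Finset.prod_congr rfl fun y _ => hX.lintegral_negExp_pointCount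
    (g.measurableSet_fiber y.1) (hg _ (hs0 _ y.2)) y.1, ← negExp_sum]
  congr 1
  have hlin : ∫⁻ x, (1 - negExp (g x)) = ∑ y ∈ s, (1 - negExp y) * volume (g ⁻¹' {y}) := by
    have h1 := (g.map fun y => 1 - negExp y).lintegral_eq_lintegral (volume : Measure Plane)
    rw [SimpleFunc.map_lintegral] at h1
    simp only [SimpleFunc.coe_map, Function.comp_apply] at h1
    rw [h1]
    refine (Finset.sum_subset (Finset.erase_subset _ _) fun y hy hy' => ?_).symm
    have : y = 0 := by
      by_contra h; exact hy' (Finset.mem_erase.2 ⟨h, hy⟩)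
    simp [this]
  rw [hlin, Finset.mul_sum, ← Finset.sum_coe_sort s]
  exact Finset.sum_congr rfl fun y _ => by ring

/-- The Laplace functional of a homogeneous Poisson process. -/
theorem IsHomogeneousPPP.lintegral_negExp_tsum [IsProbabilityMeasure P]
    (hX : IsHomogeneousPPP P X lam)
    {f : Plane → ℝ≥0∞} (hf : Measurable f) :
    ∫⁻ ω, negExp (∑' n, f (X n ω)) ∂P
      = negExp (ENNReal.ofReal lam * ∫⁻ x, (1 - negExp (f x))) := by
  -- Cutting the approximations off outside a ball gives them a support of finite area.
  let B : ℕ → Set Plane := fun k => Metric.ball 0 k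
  have hB : ∀ k, MeasurableSet (B k) := fun k => Metric.isOpen_ball.measurableSet
  let g : ℕ → SimpleFunc Plane ℝ≥0∞ := fun k => (SimpleFunc.eapprox f k).restrict (B k)
  have hgm : ∀ x, Monotone fun k => g k x := by
    intro x j k hjk
    simp only [g, SimpleFunc.restrict_apply _ (hB _)]
    refine (Set.indicator_le_indicator_of_subset (Metric.ball_subset_ball (by exact_mod_cast hjk))
      (fun _ => zero_le) x).trans
      (Set.indicator_le_indicator (SimpleFunc.monotone_eapprox f hjk x))
  have hgt : ∀ x, Tendsto (fun k => g k x) atTop (𝓝 (f x)) := by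
    intro x
    have h1 : Tendsto (fun k => SimpleFunc.eapprox f k x) atTop (𝓝 (f x)) :=
      SimpleFunc.tendsto_eapprox hf x
    refine h1.congr' ?_
    obtain ⟨m, hm⟩ := exists_nat_gt ‖x‖
    filter_upwards [eventually_ge_atTop m] with k hk
    have : x ∈ B k := by
      simp only [B, mem_ball_zero_iff]
      exact hm.trans_le (by exact_mod_cast hk)
    simp only [g, SimpleFunc.restrict_apply _ (hB _), Set.indicator_of_mem this]
  have hmain : ∀ k, ∫⁻ ω, negExp (∑' n, g k (X n ω)) ∂P
      = negExp (ENNReal.ofReal lam * ∫⁻ x, (1 - negExp (g k x))) := by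
    intro k
    refine hX.lintegral_negExp_tsum_simpleFunc _ fun y hy => ?_
    simp only [g, SimpleFunc.restrict_preimage_singleton _ (hB k) hy]
    exact ((measure_mono Set.inter_subset_left).trans_lt measure_ball_lt_top).ne
  have hL : Tendsto (fun k => ∫⁻ ω, negExp (∑' n, g k (X n ω)) ∂P) atTop
      (𝓝 (∫⁻ ω, negExp (∑' n, f (X n ω)) ∂P)) := by
    refine tendsto_lintegral_negExp (fun k => Measurable.tsum fun n =>
      (g k).measurable.comp (hX.measurable n)) fun ω => ?_
    simp_rw [← lintegral_count]
    exact lintegral_tendsto_of_tendsto_of_monotone (fun k => Measurable.of_discrete.aemeasurable)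
      (ae_of_all _ fun n => hgm _) (ae_of_all _ fun n => hgt _)
  have hR : Tendsto (fun k => negExp (ENNReal.ofReal lam * ∫⁻ x, (1 - negExp (g k x)))) atTop
      (𝓝 (negExp (ENNReal.ofReal lam * ∫⁻ x, (1 - negExp (f x))))) := by
    refine (continuous_negExp.tendsto _).comp (ENNReal.Tendsto.const_mul ?_
      (Or.inr ENNReal.ofReal_ne_top))
    refine lintegral_tendsto_of_tendsto_of_monotone
      (fun k => (measurable_const.sub (measurable_negExp.comp (g k).measurable)).aemeasurable)
      (ae_of_all _ fun x j k hjk => tsub_le_tsub_left (negExp_antitone (hgm x hjk)) _)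
      (ae_of_all _ fun x => ?_)
    exact ENNReal.Tendsto.sub tendsto_const_nhds ((continuous_negExp.tendsto _).comp (hgt x))
      (Or.inl ENNReal.one_ne_top)
  simp_rw [hmain] at hL
  exact tendsto_nhds_unique hL hR

end CacheNet

/-! ### Independent marks -/

namespace CacheNet

open Filter Topology

variable {Ω : Type*} [MeasurableSpace Ω] {P : Measure Ω} [IsProbabilityMeasure P]

/-- Expectation of a function of two independent variables as an iterated expectation. -/
lemma lintegral_of_indepFun {E F : Type*} [MeasurableSpace E] [MeasurableSpace F]
    {U : Ω → E} {V : Ω → F} (hU : Measurable U) (hV : Measurable V) (hUV : IndepFun U V P)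
    {φ : E → F → ℝ≥0∞} (hφ : Measurable (Function.uncurry φ)) :
    ∫⁻ ω, φ (U ω) (V ω) ∂P = ∫⁻ ω, ∫⁻ ω', φ (U ω) (V ω') ∂P ∂P := by
  have : IsProbabilityMeasure (P.map V) := Measure.isProbabilityMeasure_map hV.aemeasurable
  have : IsProbabilityMeasure (P.map U) := Measure.isProbabilityMeasure_map hU.aemeasurable
  have h1 := lintegral_map hφ (hU.prodMk hV) (μ := P)
  simp only [Function.uncurry_apply_pair] at h1
  rw [← h1, (indepFun_iff_map_prod_eq_prod_map_map hU.aemeasurable hV.aemeasurable).1 hUV,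
    lintegral_prod _ hφ.aemeasurable, lintegral_map hφ.lintegral_prod_right' hU]
  refine lintegral_congr fun ω => ?_
  exact lintegral_map (hφ.comp measurable_prodMk_left) hV

/-- For independent `Zₙ` the transform of the series is determined by the transforms of the
terms; the infinite product is written as the `negExp` of a series. -/
lemma lintegral_negExp_tsum_of_iIndepFun {Z : ℕ → Ω → ℝ≥0∞} (hZ : iIndepFun Z P)
    (hm : ∀ n, Measurable (Z n)) {q : ℕ → ℝ≥0∞} (hq : ∀ n, ∫⁻ ω, negExp (Z n ω) ∂P = q n) :
    ∫⁻ ω, negExp (∑' n, Z n ω) ∂P = negExp (∑' n, negLog (q n)) := by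
  have hq1 : ∀ n, q n ≤ 1 := fun n => by
    rw [← hq n]
    calc ∫⁻ ω, negExp (Z n ω) ∂P ≤ ∫⁻ _, 1 ∂P := lintegral_mono fun ω => negExp_le_one _
      _ = 1 := by simp
  have hL : Tendsto (fun k => ∫⁻ ω, negExp (∑ n ∈ Finset.range k, Z n ω) ∂P) atTop
      (𝓝 (∫⁻ ω, negExp (∑' n, Z n ω) ∂P)) :=
    tendsto_lintegral_negExp (fun k => Finset.measurable_sum _ fun n _ => hm n)
      fun ω => ENNReal.tendsto_nat_tsum fun n => Z n ω
  have hR : Tendsto (fun k => negExp (∑ n ∈ Finset.range k, negLog (q n))) atTop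
      (𝓝 (negExp (∑' n, negLog (q n)))) :=
    (continuous_negExp.tendsto _).comp (ENNReal.tendsto_nat_tsum _)
  refine tendsto_nhds_unique hL (hR.congr fun k => ?_)
  have hprod := lintegral_prod_eq_prod_lintegral_of_indepFun (Finset.range k) _
    (hZ.comp (fun _ => negExp) fun _ => measurable_negExp)
    fun n => measurable_negExp.comp (hm n)
  simp only [Function.comp_apply] at hprod
  simp_rw [negExp_sum, hprod, hq, negExp_negLog (hq1 _)]

/-- The Laplace functional of an independently marked Poisson process: averaging over the marks
turns the points into those of a process with the averaged transform `q`. -/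
theorem IsHomogeneousPPP.lintegral_negExp_tsum_marked {X : ℕ → Ω → Plane} {lam : ℝ}
    (hX : IsHomogeneousPPP P X lam) {E : Type*} [MeasurableSpace E] {Y : ℕ → Ω → E}
    (hY : ∀ n, Measurable (Y n)) (hYi : iIndepFun Y P)
    (hXY : IndepFun (fun ω n => X n ω) (fun ω n => Y n ω) P)
    {F : Plane → E → ℝ≥0∞} (hF : Measurable (Function.uncurry F))
    {q : Plane → ℝ≥0∞} (hqm : Measurable q)
    (hq : ∀ n x, ∫⁻ ω, negExp (F x (Y n ω)) ∂P = q x) :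
    ∫⁻ ω, negExp (∑' n, F (X n ω) (Y n ω)) ∂P
      = negExp (ENNReal.ofReal lam * ∫⁻ x, (1 - q x)) := by
  have hq1 : ∀ x, q x ≤ 1 := fun x => by
    rw [← hq 0 x]
    calc ∫⁻ ω, negExp (F x (Y 0 ω)) ∂P ≤ ∫⁻ _, 1 ∂P := lintegral_mono fun ω => negExp_le_one _
      _ = 1 := by simp
  have hφ : Measurable (Function.uncurry fun (x : ℕ → Plane) (y : ℕ → E) =>
      negExp (∑' n, F (x n) (y n))) := by
    refine measurable_negExp.comp (Measurable.tsum fun n => ?_)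
    exact hF.comp (by fun_prop : Measurable fun z : (ℕ → Plane) × (ℕ → E) => (z.1 n, z.2 n))
  have h := lintegral_of_indepFun (measurable_pi_lambda _ hX.measurable)
    (measurable_pi_lambda _ hY) hXY hφ
  rw [h]
  have hin : ∀ ω, ∫⁻ ω', negExp (∑' n, F (X n ω) (Y n ω')) ∂P
      = negExp (∑' n, negLog (q (X n ω))) := fun ω =>
    lintegral_negExp_tsum_of_iIndepFun
      (hYi.comp (fun n => F (X n ω)) fun n => hF.of_uncurry_left)
      (fun n => hF.of_uncurry_left.comp (hY n)) fun n => hq n _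
  simp_rw [hin]
  rw [hX.lintegral_negExp_tsum (f := fun x => negLog (q x)) (measurable_negLog.comp hqm)]
  simp_rw [negExp_negLog (hq1 _)]

end CacheNet

/-! ### Exponential variables -/

namespace CacheNet

open Filter Topology

lemma lintegral_expMeasure (r : ℝ) {f : ℝ → ℝ≥0∞} (hf : Measurable f) :
    ∫⁻ x, f x ∂(expMeasure r)
      = ∫⁻ x in Set.Ioi 0, ENNReal.ofReal (r * Real.exp (-(r * x))) * f x := by
  have h : expMeasure r = volume.withDensity (exponentialPDF r) := rfl
  have hm : Measurable (exponentialPDF r) := (measurable_exponentialPDFReal r).ennreal_ofReal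
  rw [h, lintegral_withDensity_eq_lintegral_mul _ hm hf,
    ← lintegral_indicator measurableSet_Ioi]
  have h0 : ∀ᵐ x : ℝ, x ≠ 0 := by simp [ae_iff]
  refine lintegral_congr_ae ?_
  filter_upwards [h0] with x hx
  rcases lt_or_gt_of_ne hx with h | h
  · rw [Set.indicator_of_notMem (by simpa using h.le), Pi.mul_apply, exponentialPDF_of_neg h,
      zero_mul]
  · rw [Set.indicator_of_mem (by simpa using h), Pi.mul_apply, exponentialPDF_of_nonneg h.le]

lemma ae_pos_expMeasure (r : ℝ) : ∀ᵐ x ∂(expMeasure r), 0 < x := by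
  rw [ae_iff, ← lintegral_indicator_one (by measurability),
    lintegral_expMeasure r (measurable_one.indicator (by measurability))]
  refine (setLIntegral_congr_fun measurableSet_Ioi fun x hx => ?_).trans lintegral_zero
  have : 0 < x := hx
  simp [this]

lemma expMeasure_Iic {r : ℝ} (hr : 0 < r) {x : ℝ} (hx : 0 ≤ x) :
    expMeasure r (Set.Iic x) = ENNReal.ofReal (1 - Real.exp (-(r * x))) := by
  have := isProbabilityMeasure_expMeasure hr
  have h := cdf_expMeasure_eq hr x
  rw [if_pos hx] at h
  rw [← ofReal_cdf, h]

instance nullSingletonClass_expMeasure (r : ℝ) : NullSingletonClass (expMeasure r) :=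
  inferInstanceAs (NullSingletonClass (volume.withDensity (exponentialPDF r)))

/-- The survival function of the standard exponential law. -/
lemma expMeasure_one_le (t : ℝ≥0∞) :
    expMeasure 1 {x | t ≤ ENNReal.ofReal x} = negExp t := by
  have := isProbabilityMeasure_expMeasure one_pos
  rcases eq_or_ne t ∞ with rfl | ht
  · simp
  rcases eq_or_ne t 0 with rfl | ht0
  · simp
  have hset : {x | t ≤ ENNReal.ofReal x} = (Set.Iio t.toReal)ᶜ := by
    ext x
    simp only [Set.mem_ofPred_eq, Set.compl_Iio, Set.mem_Ici]
    rcases le_or_gt x 0 with hx | hx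
    · have h1 : ¬ t ≤ ENNReal.ofReal x := by simpa [ENNReal.ofReal_of_nonpos hx] using ht0
      have h2 := ENNReal.toReal_pos ht0 ht
      exact iff_of_false h1 (by linarith)
    · exact ENNReal.le_ofReal_iff_toReal_le ht hx.le
  rw [hset, prob_compl_eq_one_sub measurableSet_Iio, measure_congr Iio_ae_eq_Iic,
    expMeasure_Iic one_pos ENNReal.toReal_nonneg, ENNReal.ofReal_sub _ (Real.exp_nonneg _),
    ← negExp_ofReal (by positivity), one_mul, ENNReal.ofReal_toReal ht, ENNReal.ofReal_one]
  exact ENNReal.sub_sub_cancel ENNReal.one_ne_top (negExp_le_one _)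

/-- Tilting an exponential law by `e^(-bt)` changes its rate. -/
lemma setLIntegral_exp_expMeasure {a b : ℝ} (ha : 0 < a) (hb : 0 ≤ b) {s : Set ℝ}
    (hs : MeasurableSet s) :
    ∫⁻ t in s, ENNReal.ofReal (Real.exp (-(b * t))) ∂(expMeasure a)
      = ENNReal.ofReal (a / (a + b)) * expMeasure (a + b) s := by
  have hab : 0 < a + b := by linarith
  have hm : Measurable fun t : ℝ => ENNReal.ofReal (Real.exp (-(b * t))) := by fun_prop
  rw [← lintegral_indicator hs, lintegral_expMeasure a (hm.indicator hs),
    ← lintegral_indicator_one hs, lintegral_expMeasure _ (measurable_one.indicator hs),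
    ← lintegral_const_mul _ (by
      refine Measurable.mul (by fun_prop) (measurable_one.indicator hs))]
  refine lintegral_congr fun t => ?_
  by_cases ht : t ∈ s
  · simp only [Set.indicator_of_mem ht, Pi.one_apply, mul_one]
    rw [← ENNReal.ofReal_mul (by positivity), ← ENNReal.ofReal_mul (by positivity)]
    congr 1
    rw [mul_assoc, ← Real.exp_add, ← mul_assoc, div_mul_cancel₀ _ hab.ne']
    ring_nf
  · simp [Set.indicator_of_notMem ht]

/-- The Laplace transform of the standard exponential law. -/
lemma lintegral_negExp_expMeasure_one (c : ℝ≥0∞) :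
    ∫⁻ x, negExp (ENNReal.ofReal x * c) ∂(expMeasure 1) = (1 + c)⁻¹ := by
  rcases eq_or_ne c ∞ with rfl | hc
  · have : ∫⁻ x, negExp (ENNReal.ofReal x * ∞) ∂(expMeasure 1) = ∫⁻ _, 0 ∂(expMeasure 1) := by
      refine lintegral_congr_ae ?_
      filter_upwards [ae_pos_expMeasure 1] with x hx
      rw [ENNReal.mul_top (by simpa using hx), negExp_top]
    simp [this]
  have h1 := setLIntegral_exp_expMeasure one_pos (ENNReal.toReal_nonneg (a := c))
    MeasurableSet.univ
  have hpos : 0 < 1 + c.toReal := by positivity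
  have := isProbabilityMeasure_expMeasure hpos
  rw [setLIntegral_univ, measure_univ, mul_one, one_div, ENNReal.ofReal_inv_of_pos hpos,
    ENNReal.ofReal_add zero_le_one ENNReal.toReal_nonneg, ENNReal.ofReal_toReal hc,
    ENNReal.ofReal_one] at h1
  rw [← h1]
  refine lintegral_congr_ae ?_
  filter_upwards [ae_pos_expMeasure 1] with x hx
  rw [← negExp_ofReal (by positivity), mul_comm c.toReal, ENNReal.ofReal_mul hx.le,
    ENNReal.ofReal_toReal hc]

/-- Fractional moments of the standard exponential law. -/
lemma lintegral_rpow_expMeasure_one {p : ℝ} (hp : -1 < p) :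
    ∫⁻ x, ENNReal.ofReal x ^ p ∂(expMeasure 1) = ENNReal.ofReal (Real.Gamma (1 + p)) := by
  rw [lintegral_expMeasure 1 (by fun_prop), Real.Gamma_eq_integral (by linarith),
    ofReal_integral_eq_lintegral_ofReal (Real.GammaIntegral_convergent (by linarith))]
  · refine setLIntegral_congr_fun measurableSet_Ioi fun x hx => ?_
    have hx : 0 < x := hx
    simp only [one_mul]
    rw [ENNReal.ofReal_rpow_of_pos hx, ← ENNReal.ofReal_mul (by positivity)]
    congr 3
    ring
  · refine (ae_restrict_iff' measurableSet_Ioi).2 (ae_of_all _ fun x hx => ?_)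
    have hx : 0 < x := hx
    positivity

/-! ### The interference integral -/

lemma volume_enorm_lt {ρ : ℝ≥0∞} (hρ : ρ ≠ ∞) :
    volume {x : Plane | ‖x‖ₑ < ρ} = ENNReal.ofReal Real.pi * ρ ^ 2 := by
  have : {x : Plane | ‖x‖ₑ < ρ} = Metric.ball 0 ρ.toReal := by
    ext x
    simp only [Set.mem_ofPred_eq, mem_ball_zero_iff]
    rw [← ofReal_norm, ENNReal.ofReal_lt_iff_lt_toReal (norm_nonneg x) hρ]
  rw [this, EuclideanSpace.volume_ball_fin_two, ENNReal.ofReal_toReal hρ, mul_comm]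

/-- The superlevel sets of a power law with negative exponent, at `y = 0` and `y = ∞` as well. -/
lemma lt_mul_rpow_neg_iff {α : ℝ} (hα : 0 < α) {e c y : ℝ≥0∞} (he : e ≠ 0) (he' : e ≠ ∞) :
    e < c * y ^ (-α) ↔ y < (c / e) ^ α⁻¹ := by
  rw [ENNReal.lt_rpow_inv_iff hα, ENNReal.rpow_neg, ← div_eq_mul_inv]
  rw [ENNReal.lt_div_iff_mul_lt (Or.inr he') (Or.inr he),
    ENNReal.lt_div_iff_mul_lt (Or.inl he) (Or.inl he'), mul_comm]

/-- The area integral of `1 - 1 / (1 + s ‖x‖^(-α))`.  For independent standard exponential `E` and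
`H` the integrand is `P(E < s H ‖x‖^(-α))`; exchanging the integrals leaves the area of a disc,
a product of powers of `E` and `H`, whose moments are the two factors of `kappa α`. -/
lemma lintegral_one_sub_inv_one_add {α : ℝ} (hα : 2 < α) {s : ℝ≥0∞} (hs : s ≠ 0) (hs' : s ≠ ∞) :
    ∫⁻ x : Plane, (1 - (1 + s * ‖x‖ₑ ^ (-α))⁻¹)
      = ENNReal.ofReal (Real.pi * kappa α) * s ^ (2 / α) := by
  have hα0 : 0 < α := by linarith
  have hp : 2 / α < 1 := (div_lt_one hα0).2 hα
  have hp0 : 0 < 2 / α := by positivity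
  have hprob := isProbabilityMeasure_expMeasure one_pos
  -- The indicator of `E < H s ‖x‖^(-α)`.
  let I : Plane → ℝ → ℝ → ℝ≥0∞ := fun x h e =>
    {e : ℝ | ENNReal.ofReal e < ENNReal.ofReal h * (s * ‖x‖ₑ ^ (-α))}.indicator 1 e
  have hI : Measurable fun z : Plane × ℝ × ℝ => I z.1 z.2.1 z.2.2 := by
    have hset : MeasurableSet {z : Plane × ℝ × ℝ |
        ENNReal.ofReal z.2.2 < ENNReal.ofReal z.2.1 * (s * ‖z.1‖ₑ ^ (-α))} :=
      measurableSet_lt (by fun_prop) (by fun_prop)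
    exact (measurable_one (α := ℝ≥0∞)).indicator hset
  have hpt : ∀ x : Plane, 1 - (1 + s * ‖x‖ₑ ^ (-α))⁻¹
      = ∫⁻ h, ∫⁻ e, I x h e ∂(expMeasure 1) ∂(expMeasure 1) := by
    intro x
    rw [← lintegral_negExp_expMeasure_one]
    have h1 : (1 : ℝ≥0∞) = ∫⁻ _, 1 ∂(expMeasure 1) := by simp
    nth_rewrite 1 [h1]
    rw [← lintegral_sub (by fun_prop)
      (((lintegral_mono fun _ => negExp_le_one _).trans_lt (by simp)).ne)
      (ae_of_all _ fun _ => negExp_le_one _)]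
    refine lintegral_congr fun h => ?_
    set t := ENNReal.ofReal h * (s * ‖x‖ₑ ^ (-α)) with ht
    have hms : MeasurableSet {e : ℝ | t ≤ ENNReal.ofReal e} :=
      measurableSet_le (by fun_prop) (by fun_prop)
    rw [← expMeasure_one_le, ← prob_compl_eq_one_sub hms, ← lintegral_indicator_one hms.compl]
    refine lintegral_congr fun e => ?_
    simp only [I, Set.indicator, Set.mem_compl_iff, Set.mem_ofPred_eq, not_le, ← ht, Pi.one_apply]
  simp_rw [hpt]
  rw [lintegral_lintegral_swap (by
    apply Measurable.aemeasurable
    refine Measurable.lintegral_prod_right' (f := fun z : (Plane × ℝ) × ℝ => I z.1.1 z.1.2 z.2) ?_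
    exact hI.comp (by fun_prop : Measurable fun z : (Plane × ℝ) × ℝ => (z.1.1, z.1.2, z.2)))]
  -- For fixed gains the area integral is the area of a disc.
  have hin : ∀ᵐ h ∂(expMeasure 1), (∫⁻ x : Plane, ∫⁻ e, I x h e ∂(expMeasure 1))
      = ENNReal.ofReal Real.pi * s ^ (2 / α) * ENNReal.ofReal (Real.Gamma (1 - 2 / α))
        * ENNReal.ofReal h ^ (2 / α) := by
    filter_upwards [ae_pos_expMeasure 1] with h hh
    rw [lintegral_lintegral_swap (f := fun x e => I x h e) (Measurable.aemeasurable
      (hI.comp (by fun_prop : Measurable fun z : Plane × ℝ => (z.1, h, z.2)))),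
      sub_eq_add_neg 1 (2 / α), ← lintegral_rpow_expMeasure_one (by linarith),
      ← lintegral_const_mul _ (by fun_prop), ← lintegral_mul_const _ (by fun_prop)]
    refine lintegral_congr_ae ?_
    filter_upwards [ae_pos_expMeasure 1] with e he
    have he0 : ENNReal.ofReal e ≠ 0 := by simpa using he
    have hh0 : ENNReal.ofReal h ≠ 0 := by simpa using hh
    have hc : ENNReal.ofReal h * s ≠ 0 := mul_ne_zero hh0 hs
    have hc' : ENNReal.ofReal h * s ≠ ∞ := ENNReal.mul_ne_top ENNReal.ofReal_ne_top hs'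
    have hρ : (ENNReal.ofReal h * s / ENNReal.ofReal e) ^ α⁻¹ ≠ ∞ :=
      ENNReal.rpow_ne_top_of_nonneg (by positivity) (ENNReal.div_ne_top hc' he0)
    have hvol := volume_enorm_lt hρ
    rw [← lintegral_indicator_one (measurableSet_lt (by fun_prop) (by fun_prop))] at hvol
    have hpow : ((ENNReal.ofReal h * s / ENNReal.ofReal e) ^ α⁻¹) ^ 2
        = ENNReal.ofReal h ^ (2 / α) * s ^ (2 / α) * ENNReal.ofReal e ^ (-(2 / α)) := by
      rw [← ENNReal.rpow_natCast, ← ENNReal.rpow_mul,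
        show α⁻¹ * ((2 : ℕ) : ℝ) = 2 / α by push_cast; ring,
        ENNReal.div_rpow_of_nonneg _ _ hp0.le, ENNReal.mul_rpow_of_nonneg _ _ hp0.le,
        ENNReal.rpow_neg, div_eq_mul_inv]
    rw [hpow] at hvol
    calc _ = ∫⁻ x : Plane, {x : Plane |
          ‖x‖ₑ < (ENNReal.ofReal h * s / ENNReal.ofReal e) ^ α⁻¹}.indicator 1 x := by
          refine lintegral_congr fun x => ?_
          simp only [I, Set.indicator, Set.mem_ofPred_eq, ← mul_assoc,
            lt_mul_rpow_neg_iff hα0 he0 ENNReal.ofReal_ne_top, Pi.one_apply]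
      _ = _ := by rw [hvol]; ring
  rw [lintegral_congr_ae hin, lintegral_const_mul _ (by fun_prop),
    lintegral_rpow_expMeasure_one (by linarith), kappa, ENNReal.ofReal_mul Real.pi_pos.le,
    ENNReal.ofReal_mul (Real.Gamma_nonneg_of_nonneg (by linarith))]
  ring

end CacheNet

/-! ### The distance to the nearest caching station -/

namespace CacheNet

open Filter Topology

variable {Ω : Type*} [MeasurableSpace Ω] {P : Measure Ω}
  {𝒞 : Type*} {c : 𝒞} {X : ℕ → Ω → Plane} {K : ℕ → Ω → Set 𝒞}

lemma measurable_nearestCachingDist (hX : ∀ n, Measurable (X n)) (hK : ∀ n, Measurable (K n)) :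
    Measurable (nearestCachingDist X K c) := by
  classical
  have : nearestCachingDist X K c = fun ω => ⨅ n, if c ∈ K n ω then ‖X n ω‖ₑ else ∞ := by
    ext ω
    unfold nearestCachingDist
    congr 1; ext n
    split_ifs with h <;> simp [h]
  rw [this]
  refine Measurable.iInf fun n => Measurable.ite ?_ (hX n).enorm measurable_const
  exact measurableSet_setOfPred.2 ((measurable_set_mem c).comp (hK n))

variable [IsProbabilityMeasure P] {lam Pc : ℝ}

/-- The void probability of the thinned process: giving each caching station in the disc of radius
`r` the weight `∞` turns it into a Laplace functional of the marked process. -/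
lemma measure_le_nearestCachingDist (hX : IsHomogeneousPPP P X lam) (hK : ∀ n, Measurable (K n))
    (hKi : iIndepFun K P) (hKp : ∀ n, P.real {ω | c ∈ K n ω} = Pc)
    (hXK : IndepFun (fun ω n => X n ω) (fun ω n => K n ω) P) {r : ℝ≥0∞} (hr : r ≠ ∞) :
    P {ω | r ≤ nearestCachingDist X K c ω}
      = negExp (ENNReal.ofReal lam * (ENNReal.ofReal Pc * (ENNReal.ofReal Real.pi * r ^ 2))) := by
  classical
  have hc : MeasurableSet {S : Set 𝒞 | c ∈ S} := measurableSet_setOfPred.2 (measurable_set_mem c)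
  have hcK : ∀ n, MeasurableSet {ω | c ∈ K n ω} := fun n => hK n hc
  have hB : MeasurableSet {x : Plane | ‖x‖ₑ < r} := measurableSet_lt (by fun_prop) (by fun_prop)
  have hPc : ∀ n, P {ω | c ∈ K n ω} = ENNReal.ofReal Pc := fun n => by
    rw [← hKp n, ofReal_measureReal]
  have hPc1 : ENNReal.ofReal Pc ≤ 1 := by rw [← hPc 0]; exact prob_le_one
  let F : Plane → Set 𝒞 → ℝ≥0∞ := fun x S => if c ∈ S ∧ ‖x‖ₑ < r then ∞ else 0
  have hF : Measurable (Function.uncurry F) := by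
    refine Measurable.ite ?_ measurable_const measurable_const
    exact (measurable_snd hc).inter (measurable_fst hB)
  let q : Plane → ℝ≥0∞ := fun x =>
    1 - {x : Plane | ‖x‖ₑ < r}.indicator (fun _ => ENNReal.ofReal Pc) x
  have hqm : Measurable q := measurable_const.sub (measurable_const.indicator hB)
  have hq : ∀ n x, ∫⁻ ω, negExp (F x (K n ω)) ∂P = q x := by
    intro n x
    by_cases hx : ‖x‖ₑ < r
    · have h1 : ∀ ω, negExp (F x (K n ω)) = {ω | c ∈ K n ω}ᶜ.indicator 1 ω := fun ω => by
        by_cases h : c ∈ K n ω <;> simp [F, h, hx]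
      simp_rw [h1]
      rw [lintegral_indicator_one (hcK n).compl, prob_compl_eq_one_sub (hcK n), hPc]
      simp [q, hx]
    · simp [F, q, hx]
  have hmain := hX.lintegral_negExp_tsum_marked hK hKi hXK hF hqm hq
  have hint : ∫⁻ x, (1 - q x) = ENNReal.ofReal Pc * (ENNReal.ofReal Real.pi * r ^ 2) := by
    rw [← volume_enorm_lt hr, ← lintegral_indicator_const hB]
    refine lintegral_congr fun x => ENNReal.sub_sub_cancel ENNReal.one_ne_top ?_
    exact Set.indicator_apply_le' (fun _ => hPc1) fun _ => zero_le
  rw [← hint, ← hmain, ← lintegral_indicator_one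
    (measurableSet_le measurable_const (measurable_nearestCachingDist hX.measurable hK))]
  refine lintegral_congr fun ω => ?_
  by_cases h : r ≤ nearestCachingDist X K c ω
  · have h0 : ∀ n, F (X n ω) (K n ω) = 0 := fun n => by
      refine if_neg fun hn => ?_
      have h2 : nearestCachingDist X K c ω ≤ ‖X n ω‖ₑ := iInf₂_le n hn.1
      exact absurd hn.2 (not_lt.2 (h.trans h2))
    simp [h, h0]
  · obtain ⟨n, hn⟩ := iInf_lt_iff.1 (not_le.1 h)
    obtain ⟨hn1, hn2⟩ := iInf_lt_iff.1 hn
    have h0 : F (X n ω) (K n ω) = ∞ := if_pos ⟨hn1, hn2⟩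
    have h1 : ∑' n, F (X n ω) (K n ω) = ∞ := ENNReal.tsum_eq_top_of_eq_top ⟨n, h0⟩
    simp [h, h1]

/-- Almost surely some station caches `c`, so that the distance keeps its meaning under `toReal`. -/
lemma ae_nearestCachingDist_ne_top (hlam : 0 < lam) (hPc : 0 < Pc)
    (hX : IsHomogeneousPPP P X lam) (hK : ∀ n, Measurable (K n))
    (hKi : iIndepFun K P) (hKp : ∀ n, P.real {ω | c ∈ K n ω} = Pc)
    (hXK : IndepFun (fun ω n => X n ω) (fun ω n => K n ω) P) :
    ∀ᵐ ω ∂P, nearestCachingDist X K c ω ≠ ∞ := by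
  have hlim : Tendsto (fun k : ℕ => negExp (ENNReal.ofReal lam *
      (ENNReal.ofReal Pc * (ENNReal.ofReal Real.pi * (k : ℝ≥0∞) ^ 2)))) atTop (𝓝 0) := by
    rw [← negExp_top]
    refine (continuous_negExp.tendsto _).comp ?_
    have h1 : Tendsto (fun k : ℕ => (k : ℝ≥0∞) ^ 2) atTop (𝓝 ∞) := by
      have := ENNReal.Tendsto.pow (n := 2) ENNReal.tendsto_nat_nhds_top
      simpa using this
    have h2 := ENNReal.Tendsto.const_mul (a := ENNReal.ofReal lam * ENNReal.ofReal Pc *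
      ENNReal.ofReal Real.pi) h1 (Or.inl ENNReal.top_ne_zero)
    rw [ENNReal.mul_top (by simp [hlam, hPc, Real.pi_pos])] at h2
    simpa [mul_assoc] using h2
  rw [ae_iff]
  refine le_antisymm (ge_of_tendsto' hlim fun k => ?_) zero_le
  rw [← measure_le_nearestCachingDist hX hK hKi hKp hXK (ENNReal.natCast_ne_top k)]
  refine measure_mono fun ω hω => ?_
  have hω : nearestCachingDist X K c ω = ∞ := not_not.1 hω
  simp [hω]

/-- The squared distance to the nearest caching station is exponential. -/
lemma hasLaw_sq_nearestCachingDist (hlam : 0 < lam) (hPc : 0 < Pc)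
    (hX : IsHomogeneousPPP P X lam) (hK : ∀ n, Measurable (K n))
    (hKi : iIndepFun K P) (hKp : ∀ n, P.real {ω | c ∈ K n ω} = Pc)
    (hXK : IndepFun (fun ω n => X n ω) (fun ω n => K n ω) P) :
    HasLaw (fun ω => (nearestCachingDist X K c ω).toReal ^ 2)
      (expMeasure (lam * Pc * Real.pi)) P := by
  have ha : 0 < lam * Pc * Real.pi := by positivity
  have := isProbabilityMeasure_expMeasure ha
  have hD := measurable_nearestCachingDist (c := c) hX.measurable hK
  have hT : Measurable fun ω => (nearestCachingDist X K c ω).toReal ^ 2 :=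
    hD.ennreal_toReal.pow_const 2
  have : IsProbabilityMeasure (P.map fun ω => (nearestCachingDist X K c ω).toReal ^ 2) :=
    Measure.isProbabilityMeasure_map hT.aemeasurable
  refine ⟨hT.aemeasurable, Measure.ext_of_Ici _ _ fun t => ?_⟩
  rw [Measure.map_apply hT measurableSet_Ici]
  rcases le_or_gt t 0 with ht | ht
  · have h1 : (fun ω => (nearestCachingDist X K c ω).toReal ^ 2) ⁻¹' Set.Ici t = Set.univ :=
      Set.eq_univ_of_forall fun ω => ht.trans (sq_nonneg _)
    have h2 : expMeasure (lam * Pc * Real.pi) (Set.Ici t) = 1 := by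
      rw [← prob_compl_eq_zero_iff measurableSet_Ici]
      refine measure_mono_null (fun x hx => ?_) (ae_iff.1 (ae_pos_expMeasure (lam * Pc * Real.pi)))
      simp only [Set.mem_compl_iff, Set.mem_Ici, not_le] at hx
      exact not_lt.2 (hx.le.trans ht)
    rw [h1, h2, measure_univ]
  · have h1 : (fun ω => (nearestCachingDist X K c ω).toReal ^ 2) ⁻¹' Set.Ici t
        =ᵐ[P] {ω | ENNReal.ofReal (√t) ≤ nearestCachingDist X K c ω} := by
      filter_upwards [ae_nearestCachingDist_ne_top hlam hPc hX hK hKi hKp hXK] with ω hω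
      refine propext ?_
      change t ≤ (nearestCachingDist X K c ω).toReal ^ 2 ↔
        ENNReal.ofReal (√t) ≤ nearestCachingDist X K c ω
      rw [ENNReal.ofReal_le_iff_le_toReal hω, Real.sqrt_le_left ENNReal.toReal_nonneg]
    rw [measure_congr h1, measure_le_nearestCachingDist hX hK hKi hKp hXK ENNReal.ofReal_ne_top,
      ← Set.compl_Iio, prob_compl_eq_one_sub measurableSet_Iio, measure_congr Iio_ae_eq_Iic,
      expMeasure_Iic ha ht.le, ← ENNReal.ofReal_pow (Real.sqrt_nonneg t), Real.sq_sqrt ht.le,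
      ENNReal.ofReal_sub _ (Real.exp_nonneg _), ENNReal.ofReal_one,
      ENNReal.sub_sub_cancel ENNReal.one_ne_top
        (by simpa using mul_nonneg ha.le ht.le),
      ← negExp_ofReal (by positivity)]
    congr 1
    rw [ENNReal.ofReal_mul ha.le, ENNReal.ofReal_mul (by positivity), ENNReal.ofReal_mul hlam.le]
    ring

end CacheNet

/-! ### The reference link -/

namespace CacheNet

open Filter Topology

variable {Ω : Type*} [MeasurableSpace Ω] {P : Measure Ω}
  {𝒞 : Type*} [Finite 𝒞] {c : 𝒞} {lam Pc Rth α γ : ℝ}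
  {X : ℕ → Ω → Plane} {K : ℕ → Ω → Set 𝒞} {h : ℕ → Ω → ℝ} {h₀ R : Ω → ℝ}

namespace IsCacheNetwork

/-- The five components, indexed as in `IsCacheNetwork.indep`, split into independent blocks. -/
lemma indep_blocks (hnet : IsCacheNetwork P c lam Pc Rth X K h h₀ R) :
    IndepFun (fun ω => (R ω, (fun n => X n ω), (fun n => h n ω))) h₀ P ∧
      IndepFun R (fun ω => ((fun n => X n ω), (fun n => h n ω))) P := by
  set m : Fin 5 → MeasurableSpace Ω := ![
    MeasurableSpace.comap (fun ω n => X n ω) inferInstance,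
    MeasurableSpace.comap (fun ω n => K n ω) inferInstance,
    MeasurableSpace.comap (fun ω n => h n ω) inferInstance,
    MeasurableSpace.comap h₀ inferInstance,
    MeasurableSpace.comap R inferInstance] with hm
  have hle : ∀ i, m i ≤ ‹MeasurableSpace Ω› := by
    intro i
    fin_cases i
    · exact (measurable_pi_lambda _ hnet.ppp.measurable).comap_le
    · exact (measurable_pi_lambda _ hnet.cache_measurable).comap_le
    · exact (measurable_pi_lambda _ hnet.fading_measurable).comap_le
    · exact hnet.ref_fading_measurable.comap_le
    · exact hnet.ref_dist_measurable.comap_le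
  have hsub : ∀ {T : Set (Fin 5)} {i : Fin 5}, i ∈ T → m i ≤ ⨆ j ∈ T, m j :=
    fun hi => le_iSup₂_of_le _ hi le_rfl
  constructor
  · have h1 := indep_iSup_of_disjoint hle hnet.indep (S := {0, 2, 4}) (T := {3}) (by simp)
    refine indep_of_indep_of_le_left (indep_of_indep_of_le_right h1
      (hsub (Set.mem_singleton 3))) ?_
    refine Measurable.comap_le ?_
    refine Measurable.prodMk ?_ (Measurable.prodMk ?_ ?_)
    · exact measurable_iff_comap_le.2 (hsub (i := 4) (by simp))
    · exact measurable_iff_comap_le.2 (hsub (i := 0) (by simp))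
    · exact measurable_iff_comap_le.2 (hsub (i := 2) (by simp))
  · have h1 := indep_iSup_of_disjoint hle hnet.indep (S := {4}) (T := {0, 2}) (by simp)
    refine indep_of_indep_of_le_left (indep_of_indep_of_le_right h1 ?_)
      (hsub (Set.mem_singleton 4))
    refine Measurable.comap_le ?_
    refine Measurable.prodMk ?_ ?_
    · exact measurable_iff_comap_le.2 (hsub (i := 0) (by simp))
    · exact measurable_iff_comap_le.2 (hsub (i := 2) (by simp))

lemma measurable_interference (hnet : IsCacheNetwork P c lam Pc Rth X K h h₀ R) :
    Measurable (interference α X h) :=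
  Measurable.tsum fun n => (hnet.fading_measurable n).ennreal_ofReal.mul
    ((hnet.ppp.measurable n).enorm.pow_const _)

lemma measurable_sir (hnet : IsCacheNetwork P c lam Pc Rth X K h h₀ R) :
    Measurable (sir α X h h₀ R) :=
  (hnet.ref_fading_measurable.ennreal_ofReal.mul
    (hnet.ref_dist_measurable.ennreal_ofReal.pow_const _)).div hnet.measurable_interference

variable [IsProbabilityMeasure P]

lemma hasLaw_sq_nearest (hnet : IsCacheNetwork P c lam Pc Rth X K h h₀ R) (hlam : 0 < lam)
    (hPc : 0 < Pc) :
    HasLaw (fun ω => (nearestCachingDist X K c ω).toReal ^ 2)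
      (expMeasure (lam * Pc * Real.pi)) P :=
  hasLaw_sq_nearestCachingDist hlam hPc hnet.ppp hnet.cache_measurable hnet.cache_indep
    hnet.cache_prob (hnet.indep.indep (i := 0) (j := 1) (by decide))

/-- The reference length is almost surely positive, so its power `R ^ (-α)` is finite. -/
lemma ae_ref_dist_pos (hnet : IsCacheNetwork P c lam Pc Rth X K h h₀ R) (hlam : 0 < lam)
    (hPc : 0 < Pc) : ∀ᵐ ω ∂P, 0 < R ω := by
  refine hnet.ref_dist_law.symm.ae_snd (p := fun r => 0 < r) measurableSet_Ioi ?_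
  refine cond_absolutelyContinuous.ae_le ?_
  have h1 := ((hnet.hasLaw_sq_nearest hlam hPc).ae_iff (p := fun t => 0 < t)
    (measurableSet_setOfPred.1 measurableSet_Ioi)).2 (ae_pos_expMeasure _)
  filter_upwards [h1] with ω hω
  exact lt_of_le_of_ne ENNReal.toReal_nonneg fun h0 => by simp [← h0] at hω

/-- The transform of the squared reference distance, an exponential variable conditioned to lie
below `Rth ^ 2`. -/
lemma lintegral_exp_sq_ref_dist (hnet : IsCacheNetwork P c lam Pc Rth X K h h₀ R)
    (hlam : 0 < lam) (hPc : 0 < Pc) (hRth : 0 < Rth) {b : ℝ} (hb : 0 ≤ b) :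
    ∫⁻ ω, ENNReal.ofReal (Real.exp (-(b * R ω ^ 2))) ∂P
      = ENNReal.ofReal (lam * Pc * Real.pi / (lam * Pc * Real.pi + b)
        * (1 - Real.exp (-((lam * Pc * Real.pi + b) * Rth ^ 2)))
        / (1 - Real.exp (-(lam * Pc * Real.pi * Rth ^ 2)))) := by
  set a := lam * Pc * Real.pi with ha'
  have ha : 0 < a := by positivity
  have hab : 0 < a + b := by linarith
  have hlaw := hnet.hasLaw_sq_nearest hlam hPc
  have hD := measurable_nearestCachingDist (c := c) hnet.ppp.measurable hnet.cache_measurable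
  have hu : Measurable fun r : ℝ => ENNReal.ofReal (Real.exp (-(b * r ^ 2))) := by fun_prop
  have hm : Measurable fun t : ℝ => ENNReal.ofReal (Real.exp (-(b * t))) := by fun_prop
  have hS : MeasurableSet (Set.Iio (Rth ^ 2)) := measurableSet_Iio
  -- Up to a null set the hit event says that the squared distance is below `Rth ^ 2`.
  have hhit : hitEvent X K c Rth
      =ᵐ[P] (fun ω => (nearestCachingDist X K c ω).toReal ^ 2) ⁻¹' Set.Iio (Rth ^ 2) := by
    filter_upwards [ae_nearestCachingDist_ne_top hlam hPc hnet.ppp hnet.cache_measurable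
      hnet.cache_indep hnet.cache_prob (hnet.indep.indep (i := 0) (j := 1) (by decide))] with ω hω
    refine propext ?_
    change nearestCachingDist X K c ω < ENNReal.ofReal Rth ↔
      (nearestCachingDist X K c ω).toReal ^ 2 < Rth ^ 2
    rw [ENNReal.lt_ofReal_iff_toReal_lt hω, sq_lt_sq₀ ENNReal.toReal_nonneg hRth.le]
  have hPhit : P (hitEvent X K c Rth) = ENNReal.ofReal (1 - Real.exp (-(a * Rth ^ 2))) := by
    rw [measure_congr hhit, ← Measure.map_apply_of_aemeasurable hlaw.aemeasurable hS,
      hlaw.map_eq, measure_congr Iio_ae_eq_Iic, expMeasure_Iic ha (sq_nonneg _)]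
  have hint : ∫⁻ ω in hitEvent X K c Rth,
      ENNReal.ofReal (Real.exp (-(b * (nearestCachingDist X K c ω).toReal ^ 2))) ∂P
      = ENNReal.ofReal (a / (a + b) * (1 - Real.exp (-((a + b) * Rth ^ 2)))) := by
    rw [setLIntegral_congr hhit, ENNReal.ofReal_mul (by positivity),
      ← expMeasure_Iic hab (sq_nonneg _), ← measure_congr Iio_ae_eq_Iic,
      ← setLIntegral_exp_expMeasure ha hb hS, ← hlaw.map_eq,
      setLIntegral_map hS hm (hD.ennreal_toReal.pow_const 2)]
  have hpos : 0 < 1 - Real.exp (-(a * Rth ^ 2)) := by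
    rw [sub_pos, Real.exp_lt_one_iff]
    exact neg_neg_of_pos (by positivity)
  have hR := (hnet.ref_dist_law.comp hu).lintegral_eq
  simp only [Function.comp_apply] at hR
  rw [hR, ProbabilityTheory.cond, lintegral_smul_measure, hint, hPhit, smul_eq_mul,
    ← ENNReal.ofReal_inv_of_pos hpos, ← ENNReal.ofReal_mul (by positivity)]
  congr 1
  rw [div_eq_mul_inv _ (1 - _), mul_comm]

/-- The transform of the interference at level `s`: the exponential gains average out and the
area integral is `lintegral_one_sub_inv_one_add`. -/
lemma lintegral_negExp_interference (hnet : IsCacheNetwork P c lam Pc Rth X K h h₀ R)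
    (hα : 2 < α) {s : ℝ≥0∞} (hs : s ≠ 0) (hs' : s ≠ ∞) :
    ∫⁻ ω, negExp (s * interference α X h ω) ∂P
      = negExp (ENNReal.ofReal lam * (ENNReal.ofReal (Real.pi * kappa α) * s ^ (2 / α))) := by
  rw [← lintegral_one_sub_inv_one_add hα hs hs', ← hnet.ppp.lintegral_negExp_tsum_marked
    hnet.fading_measurable hnet.fading_indep (hnet.indep.indep (i := 0) (j := 2) (by decide))
    (F := fun x g => ENNReal.ofReal g * (s * ‖x‖ₑ ^ (-α))) (by fun_prop) (by fun_prop)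
    (fun n x => ?_)]
  · refine lintegral_congr fun ω => ?_
    rw [interference, ← ENNReal.tsum_mul_left]
    congr 2; ext n
    ring
  · rw [(hnet.fading_law n).lintegral_comp
      (f := fun g => negExp (ENNReal.ofReal g * (s * ‖x‖ₑ ^ (-α)))) (by fun_prop)]
    exact lintegral_negExp_expMeasure_one _

/-- The coverage probability as an expectation over the reference distance only.  Given everything
but `h₀`, the event `γ ≤ SIR` is `γ R^α I ≤ h₀`, of probability `exp (-γ R^α I)`. -/
lemma measure_le_sir (hnet : IsCacheNetwork P c lam Pc Rth X K h h₀ R) (hlam : 0 < lam)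
    (hPc : 0 < Pc) (hα : 2 < α) (hγ : 0 < γ) :
    P {ω | ENNReal.ofReal γ ≤ sir α X h h₀ R ω}
      = ∫⁻ ω, ENNReal.ofReal
          (Real.exp (-(lam * Real.pi * kappa α * γ ^ (2 / α) * R ω ^ 2))) ∂P := by
  have hα0 : 0 < α := by linarith
  have hp0 : 0 < 2 / α := by positivity
  have hκ : 0 < kappa α := mul_pos (Real.Gamma_pos_of_pos (by linarith))
    (Real.Gamma_pos_of_pos (sub_pos.2 ((div_lt_one hα0).2 hα)))
  obtain ⟨hi1, hi2⟩ := hnet.indep_blocks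
  have hXm : Measurable fun ω n => X n ω := measurable_pi_lambda _ hnet.ppp.measurable
  have hhm : Measurable fun ω n => h n ω := measurable_pi_lambda _ hnet.fading_measurable
  have hRm := hnet.ref_dist_measurable
  let I : (ℕ → Plane) × (ℕ → ℝ) → ℝ≥0∞ := fun z =>
    ∑' n, ENNReal.ofReal (z.2 n) * ‖z.1 n‖ₑ ^ (-α)
  have hI : Measurable I := Measurable.tsum fun n => by fun_prop
  let s : ℝ → ℝ≥0∞ := fun r => ENNReal.ofReal γ * ENNReal.ofReal r ^ α
  have hsm : Measurable s := by fun_prop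
  let S : Set ((ℝ × (ℕ → Plane) × (ℕ → ℝ)) × ℝ) := {z | s z.1.1 * I z.1.2 ≤ ENNReal.ofReal z.2}
  have hS : MeasurableSet S := measurableSet_le
    ((hsm.comp (by fun_prop)).mul (hI.comp (by fun_prop))) (by fun_prop)
  have hpos0 : ∀ᵐ ω ∂P, 0 < h₀ ω := (hnet.ref_fading_law.ae_iff (p := fun t => 0 < t)
    (measurableSet_setOfPred.1 measurableSet_Ioi)).2 (ae_pos_expMeasure _)
  -- A positive finite numerator excludes the junk quotients `0 / 0` and `∞ / ∞`.
  have hev : {ω | ENNReal.ofReal γ ≤ sir α X h h₀ R ω}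
      =ᵐ[P] {ω | ((R ω, (fun n => X n ω), (fun n => h n ω)), h₀ ω) ∈ S} := by
    filter_upwards [hpos0, hnet.ae_ref_dist_pos hlam hPc] with ω h0 hR
    refine propext ?_
    change ENNReal.ofReal γ ≤ sir α X h h₀ R ω ↔
      ENNReal.ofReal γ * ENNReal.ofReal (R ω) ^ α * interference α X h ω ≤ ENNReal.ofReal (h₀ ω)
    have hR0 : ENNReal.ofReal (R ω) ^ α ≠ 0 := by simp [hR]
    have hR1 : ENNReal.ofReal (R ω) ^ α ≠ ∞ :=
      ENNReal.rpow_ne_top_of_nonneg hα0.le ENNReal.ofReal_ne_top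
    have h00 : ENNReal.ofReal (h₀ ω) ≠ 0 := by simpa using h0
    have hA0 : ENNReal.ofReal (h₀ ω) / ENNReal.ofReal (R ω) ^ α ≠ 0 :=
      ENNReal.div_ne_zero.2 ⟨h00, hR1⟩
    have hA1 : ENNReal.ofReal (h₀ ω) / ENNReal.ofReal (R ω) ^ α ≠ ∞ :=
      ENNReal.div_ne_top ENNReal.ofReal_ne_top hR0
    rw [sir, ENNReal.rpow_neg, ← div_eq_mul_inv,
      ENNReal.le_div_iff_mul_le (Or.inr hA0) (Or.inr hA1),
      ENNReal.le_div_iff_mul_le (Or.inl hR0) (Or.inl hR1)]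
    ring_nf
  have hmeas : Measurable fun ω => ((R ω, (fun n => X n ω), (fun n => h n ω)), h₀ ω) :=
    (hRm.prodMk (hXm.prodMk hhm)).prodMk hnet.ref_fading_measurable
  have hin : ∀ ω, ∫⁻ ω', S.indicator (fun _ => (1 : ℝ≥0∞))
      ((R ω, (fun n => X n ω), (fun n => h n ω)), h₀ ω') ∂P
      = negExp (s (R ω) * interference α X h ω) := by
    intro ω
    have hms : MeasurableSet {e : ℝ | s (R ω) * interference α X h ω ≤ ENNReal.ofReal e} :=
      measurableSet_le (by fun_prop) (by fun_prop)
    rw [← expMeasure_one_le, ← hnet.ref_fading_law.measure_eq hms]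
    exact lintegral_indicator_one (hnet.ref_fading_measurable hms)
  have hP := lintegral_indicator_one (μ := P) (hmeas hS)
  refine (measure_congr hev).trans (hP.symm.trans ?_)
  have h1 := lintegral_of_indepFun (hRm.prodMk (hXm.prodMk hhm)) hnet.ref_fading_measurable hi1
    (φ := fun v e => S.indicator (fun _ => (1 : ℝ≥0∞)) (v, e)) (measurable_const.indicator hS)
  have h2 := lintegral_of_indepFun hRm (hXm.prodMk hhm) hi2
    (φ := fun r z => negExp (s r * I z))
    (measurable_negExp.comp ((hsm.comp measurable_fst).mul (hI.comp measurable_snd)))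
  refine h1.trans ((lintegral_congr hin).trans (h2.trans (lintegral_congr_ae ?_)))
  filter_upwards [hnet.ae_ref_dist_pos hlam hPc] with ω hR
  have hR0 : 0 < R ω ^ α := Real.rpow_pos_of_pos hR α
  have hs0 : s (R ω) = ENNReal.ofReal (γ * R ω ^ α) := by
    rw [ENNReal.ofReal_mul hγ.le, ← ENNReal.ofReal_rpow_of_pos hR]
  have hγR : 0 < γ * R ω ^ α := by positivity
  have h3 := hnet.lintegral_negExp_interference hα (s := s (R ω))
    (by rw [hs0]; simpa using hγR) (by rw [hs0]; exact ENNReal.ofReal_ne_top)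
  refine h3.trans ?_
  rw [← negExp_ofReal (by positivity), hs0, ENNReal.ofReal_rpow_of_pos hγR,
    ← ENNReal.ofReal_mul (by positivity), ← ENNReal.ofReal_mul hlam.le,
    Real.mul_rpow hγ.le hR0.le, ← Real.rpow_mul hR.le, mul_div_cancel₀ _ hα0.ne',
    Real.rpow_two]
  congr 2
  ring

end IsCacheNetwork

/-! ### Uniform caching -/

variable [IsProbabilityMeasure P]

/-- If every station stores a uniformly chosen `d`-subset, a fixed content is stored with
probability `d / |𝒞|`: there are `(|𝒞| - 1).choose (d - 1)` such subsets containing it. -/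
lemma UniformCaching.measureReal_mem {d : ℕ} (hU : UniformCaching P K d)
    (hK : ∀ n, Measurable (K n)) (n : ℕ) :
    P.real {ω | c ∈ K n ω} = (d : ℝ) / (Nat.card 𝒞 : ℝ) := by
  classical
  have := Fintype.ofFinite 𝒞
  obtain ⟨hd, hU⟩ := hU
  rw [Nat.card_eq_fintype_card] at *
  set N := Fintype.card 𝒞
  have hN : 0 < N := Fintype.card_pos_iff.2 ⟨c⟩
  have hch : 0 < N.choose d := Nat.choose_pos hd
  have hfib : ∀ T : Finset 𝒞, MeasurableSet {ω | K n ω = (T : Set 𝒞)} := fun T =>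
    hK n (measurableSet_singleton _)
  have hdis : ∀ A : Finset (Finset 𝒞), P.real {ω | ∃ T ∈ A, K n ω = (T : Set 𝒞)}
      = ∑ T ∈ A, P.real {ω | K n ω = (T : Set 𝒞)} := by
    intro A
    rw [← measureReal_biUnion_finset _ fun T _ => hfib T]
    · congr 1; ext ω; simp
    · intro T _ T' _ hTT'
      refine Set.disjoint_left.2 fun ω h1 h2 => hTT' ?_
      exact Finset.coe_injective ((show K n ω = T from h1).symm.trans h2)
  have hval : ∀ A ⊆ Finset.powersetCard d (Finset.univ : Finset 𝒞),
      P.real {ω | ∃ T ∈ A, K n ω = (T : Set 𝒞)} = A.card * ((N.choose d : ℝ))⁻¹ := by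
    intro A hA
    have hT : ∀ T ∈ A, P.real {ω | K n ω = (T : Set 𝒞)} = (N.choose d : ℝ)⁻¹ := fun T hT =>
      hU n T (by rw [Set.ncard_coe_finset]; exact (Finset.mem_powersetCard.1 (hA hT)).2)
    rw [hdis, Finset.sum_congr rfl hT, Finset.sum_const, nsmul_eq_mul]
  have htot := hval _ subset_rfl
  rw [Finset.card_powersetCard, Finset.card_univ,
    mul_inv_cancel₀ (by exact_mod_cast hch.ne')] at htot
  -- The prescribed probabilities already sum to `1`, so other cache sizes do not occur.
  have hae : ∀ᵐ ω ∂P, ∃ T ∈ Finset.powersetCard d (Finset.univ : Finset 𝒞),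
      K n ω = (T : Set 𝒞) := by
    have hms : MeasurableSet {ω | ∃ T ∈ Finset.powersetCard d (Finset.univ : Finset 𝒞),
        K n ω = (T : Set 𝒞)} := by
      have : {ω | ∃ T ∈ Finset.powersetCard d (Finset.univ : Finset 𝒞), K n ω = (T : Set 𝒞)}
          = ⋃ T ∈ Finset.powersetCard d (Finset.univ : Finset 𝒞), {ω | K n ω = (T : Set 𝒞)} := by
        ext ω; simp
      rw [this]
      exact Finset.measurableSet_biUnion _ fun T _ => hfib T
    rw [ae_iff]
    refine (prob_compl_eq_zero_iff hms).2 ?_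
    rwa [measureReal_def, ENNReal.toReal_eq_one_iff] at htot
  have hev : {ω | c ∈ K n ω} =ᵐ[P] {ω | ∃ T ∈ (Finset.powersetCard d
      (Finset.univ : Finset 𝒞)).filter (c ∈ ·), K n ω = (T : Set 𝒞)} := by
    filter_upwards [hae] with ω hω
    refine propext ?_
    change c ∈ K n ω ↔ ∃ T ∈ (Finset.powersetCard d
      (Finset.univ : Finset 𝒞)).filter (c ∈ ·), K n ω = (T : Set 𝒞)
    constructor
    · intro hc
      obtain ⟨T, hT, hTK⟩ := hω
      rw [hTK] at hc
      exact ⟨T, Finset.mem_filter.2 ⟨hT, by exact_mod_cast hc⟩, hTK⟩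
    · rintro ⟨T, hT, hTK⟩
      rw [hTK]
      exact_mod_cast (Finset.mem_filter.1 hT).2
  rw [measureReal_congr hev, hval _ (Finset.filter_subset _ _)]
  have hcount : ((Finset.powersetCard d (Finset.univ : Finset 𝒞)).filter (c ∈ ·)).card * N
      = d * N.choose d := by
    -- The `d`-subsets avoiding `c` are the `d`-subsets of the other contents.
    have h1 := Finset.card_filter_add_card_filter_not (s := Finset.powersetCard d
      (Finset.univ : Finset 𝒞)) (c ∈ ·)
    have h2 : (Finset.powersetCard d (Finset.univ : Finset 𝒞)).filter (c ∉ ·)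
        = Finset.powersetCard d (Finset.univ.erase c) := by
      ext T
      simp only [Finset.mem_filter, Finset.mem_powersetCard, Finset.subset_univ, true_and,
        Finset.subset_erase]
      exact and_comm
    obtain ⟨M, hM⟩ : ∃ M, N = M + 1 := ⟨N - 1, by omega⟩
    rw [h2, Finset.card_powersetCard, Finset.card_powersetCard,
      Finset.card_erase_of_mem (Finset.mem_univ c), Finset.card_univ,
      show Fintype.card 𝒞 = M + 1 from hM, Nat.add_sub_cancel] at h1
    rw [hM] at hd ⊢
    have h3 := Nat.choose_mul_succ_eq M d
    obtain ⟨e, he⟩ := Nat.exists_eq_add_of_le hd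
    rw [show M + 1 - d = e by omega] at h3
    rw [← h1] at h3 ⊢
    rw [he] at h3 ⊢
    nlinarith
  have hN' : (N : ℝ) ≠ 0 := by exact_mod_cast hN.ne'
  have hch' : (N.choose d : ℝ) ≠ 0 := by exact_mod_cast hch.ne'
  rw [← div_eq_mul_inv, div_eq_div_iff hch' hN']
  exact_mod_cast hcount

end CacheNet

theorem mainTheorem1 {Ω : Type*} [MeasurableSpace Ω] (P : Measure Ω) [IsProbabilityMeasure P]
    {𝒞 : Type*} [Finite 𝒞] (c : 𝒞) (lam Pc Rth α γ : ℝ)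
    (hlam : 0 < lam) (hPc : 0 < Pc) (hRth : 0 < Rth) (hα : 2 < α) (hγ : 0 < γ)
    (X : ℕ → Ω → CacheNet.Plane) (K : ℕ → Ω → Set 𝒞) (h : ℕ → Ω → ℝ) (h₀ R : Ω → ℝ)
    (hnet : CacheNet.IsCacheNetwork P c lam Pc Rth X K h h₀ R) :
    CacheNet.contentOutageProb P α γ X h h₀ R =
        1 - Pc * (1 - Real.exp (-lam * (Pc + CacheNet.kappa α * γ ^ (2 / α)) * Real.pi * Rth ^ 2)) /
          ((1 - Real.exp (-lam * Pc * Real.pi * Rth ^ 2)) *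
            (Pc + CacheNet.kappa α * γ ^ (2 / α))) ∧
      (∀ d : ℕ, CacheNet.UniformCaching P K d → Pc = (d : ℝ) / (Nat.card 𝒞 : ℝ)) := by
  refine ⟨?_, fun d hd => ?_⟩
  · have hα0 : 0 < α := by linarith
    have hκ : 0 < CacheNet.kappa α := mul_pos
      (Real.Gamma_pos_of_pos (by linarith [show 0 < 2 / α by positivity]))
      (Real.Gamma_pos_of_pos (sub_pos.2 ((div_lt_one hα0).2 hα)))
    have hcompl : {ω | CacheNet.sir α X h h₀ R ω < ENNReal.ofReal γ}
        = {ω | ENNReal.ofReal γ ≤ CacheNet.sir α X h h₀ R ω}ᶜ := by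
      ext ω; simp
    have hg : 0 < γ ^ (2 / α) := Real.rpow_pos_of_pos hγ _
    have hms : MeasurableSet {ω | ENNReal.ofReal γ ≤ CacheNet.sir α X h h₀ R ω} :=
      measurableSet_le measurable_const hnet.measurable_sir
    rw [CacheNet.contentOutageProb, hcompl, probReal_compl_eq_one_sub hms, measureReal_def,
      hnet.measure_le_sir hlam hPc hα hγ,
      hnet.lintegral_exp_sq_ref_dist hlam hPc hRth (by positivity)]
    set g := CacheNet.kappa α * γ ^ (2 / α) with hgdef
    have hgpos : 0 < g := by positivity
    have h1 : lam * Pc * Real.pi + lam * Real.pi * CacheNet.kappa α * γ ^ (2 / α)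
        = lam * Real.pi * (Pc + g) := by rw [hgdef]; ring
    have hE1 : 0 < 1 - Real.exp (-(lam * Pc * Real.pi * Rth ^ 2)) := by
      rw [sub_pos, Real.exp_lt_one_iff]
      exact neg_neg_of_pos (by positivity)
    have hE2 : 0 < 1 - Real.exp (-(lam * Real.pi * (Pc + g) * Rth ^ 2)) := by
      rw [sub_pos, Real.exp_lt_one_iff]
      exact neg_neg_of_pos (by positivity)
    rw [h1, ENNReal.toReal_ofReal (by positivity),
      show -lam * (Pc + g) * Real.pi * Rth ^ 2 = -(lam * Real.pi * (Pc + g) * Rth ^ 2) by ring,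
      show -lam * Pc * Real.pi * Rth ^ 2 = -(lam * Pc * Real.pi * Rth ^ 2) by ring]
    have : lam * Pc * Real.pi / (lam * Real.pi * (Pc + g)) = Pc / (Pc + g) := by
      field_simp
    rw [this]
    congr 1
    rw [div_mul_eq_mul_div, div_div, mul_comm (Pc + g)]
  · rw [← hnet.cache_prob 0]
    exact hd.measureReal_mem hnet.cache_measurable 0
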